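/- A directed container consists of a set $S$ of shapes, sets $P\,s$ of positions ($s\in S$), and operations giving the subshape $s\downarrow p\in S$ for $p\in P\,s$, the root $\mathsf o_s\in P\,s$, and $p\oplus p'\in P\,s$ for $p\in P\,s$, $p'\in P(s\downarrow p)$, such that $s\downarrow\mathsf o=s$, $s\downarrow(p\oplus p')=(s\downarrow p)\downarrow p'$, $p\oplus\mathsf o=p$, $\mathsf o\oplus p=p$, $(p\oplus p')\oplus p''=p\oplus(p'\oplus p'')$. A morphism $(S,P,\downarrow,\mathsf o,\oplus)\to(S',P',\downarrow',\mathsf o',\oplus')$ is a map $t:S\to S'$ with maps $q_s:P'(t\,s)\to P\,s$ such that $t(s\downarrow q\,p)=t\,s\downarrow' p$, $q\,\mathsf o'=\mathsf o$, $q\,p\oplus q\,p'=q(p\oplus' p')$. A directed container is interpreted as the comonad on $\mathbf{Set}$ with $D X=\sum_{s\in S}(P\,s\to X)$, $\varepsilon(s,v)=v\,\mathsf o_s$, $\delta(s,v)=(s,\lambda p.\,(s\downarrow p,\lambda p'.\,v(p\oplus p')))$, and a morphism as the comonad morphism $(s,v)\mapsto(t\,s,v\circ q_s)$. A strict directed container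 is $(S,P^+,\downarrow^+,\oplus^+)$, with operations typed like $\downarrow$ and $\oplus$, satisfying $s\downarrow^+(p\oplus^+p')=(s\downarrow^+p)\downarrow^+p'$ and $(p\oplus^+p')\oplus^+p''=p\oplus^+(p'\oplus^+p'')$. It induces the directed container with shapes $S$ and positions $P\,s=1+P^+s$ obtained by freely adding a root. Its interpreting coideal comonad has $D^+X=\sum_{s\in S}(P^+s\to X)$ and $\delta^+(s,v)=(s,\lambda p.\,(v\,p,(s\downarrow^+p,\lambda p'.\,v(p\oplus^+p'))))$; the corresponding comonad is $DX=X\times D^+X$ with $\varepsilon=\mathsf{fst}$, $\delta=\langle\mathrm{id},\delta^+\circ\mathsf{snd}\rangle$, and it is canonically isomorphic to the comonad interpreting the induced directed container. Let $E_i=(S_i,P_i^+,\downarrow_i^+,\oplus_i^+)$, $i=0,1$, be strict directed containers. Define $E=(S,P^+,\downarrow^+,\oplus^+)$ as follows. Let $(\overline{S_0},\overline{S_1})$ be the final coalgebra of $(Z_0,Z_1)\mapsto\bigl(\sum_{s_0\in S_0}(P_0^+s_0\to Z_1),\ \sum_{s_1\in S_1}(P_1^+s_1\to Z_0)\bigr)$,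 elements being written as pairs $(s_i,v_i)$, and let $S=\overline{S_0}\times\overline{S_1}$. Let $(\overline{P_0},\overline{P_1})$ be the initial algebra, among pairs of families over $\overline{S_0},\overline{S_1}$, given by $$\overline{P_i}(s_i,v_i)=\sum_{p_i\in P_i^+s_i}\bigl(1+\overline{P_{1-i}}(v_i\,p_i)\bigr),$$ with elements $(p_i,\mathsf{nothing})$ and $(p_i,\mathsf{just}\,p)$, and let $P^+(a_0,a_1)=\overline{P_0}\,a_0+\overline{P_1}\,a_1$. Let $(a_0,a_1)\downarrow^+\mathsf{in}_i\,p=a_i\mathbin{\overline{\downarrow_i}}p$, where $(s_i,v_i)\mathbin{\overline{\downarrow_i}}(p_i,\mathsf{nothing})$ is the pair in $S$ whose component in $\overline{S_i}$ is $(s_i\downarrow_i^+p_i,\lambda p.\,v_i(p_i\oplus_i^+p))$ and whose other component is $v_i\,p_i$, and $(s_i,v_i)\mathbin{\overline{\downarrow_i}}(p_i,\mathsf{just}\,p)=v_i\,p_i\mathbin{\overline{\downarrow_{1-i}}}p$. Let $\mathsf{in}_i\,p\oplus^+p'=\mathsf{in}_i(p\mathbin{\overline{\oplus_i}}p')$,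 where $(p_i,\mathsf{nothing})\mathbin{\overline{\oplus_i}}\mathsf{in}_i(p_i',r)=(p_i\oplus_i^+p_i',r)$, $(p_i,\mathsf{nothing})\mathbin{\overline{\oplus_i}}\mathsf{in}_{1-i}\,p=(p_i,\mathsf{just}\,p)$, and $(p_i,\mathsf{just}\,p)\mathbin{\overline{\oplus_i}}p'=(p_i,\mathsf{just}(p\mathbin{\overline{\oplus_{1-i}}}p'))$. Then $E$ is a strict directed container, and there are directed container morphisms $\pi_0:E\to E_0$ and $\pi_1:E\to E_1$ (between the induced directed containers) such that $(E,\pi_0,\pi_1)$ is a product of $E_0$ and $E_1$ in the category of all directed containers, and such that the interpretation of $(E,\pi_0,\pi_1)$ is a product, in the category of all comonads on $\mathbf{Set}$, of the comonads interpreting $E_0$ and $E_1$; equivalently (along the canonical isomorphisms) of their interpreting coideal comonads. -/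

import Mathlib

open CategoryTheory CategoryTheory.Limits

universe u

/-! ### Directed containers and their morphisms -/

/-- A directed container: shapes `S`, positions `P`, the subshape `down s p` at a position, the root
`root s`, and the translation `plus p p'` of positions `p'` of the subshape at `p`. -/
structure DirectedContainer : Type (u + 1) where
  S : Type u
  P : S → Type u
  down : (s : S) → P s → S
  root : (s : S) → P s
  plus : {s : S} → (p : P s) → P (down s p) → P s
  down_root : ∀ s, down s (root s) = s
  down_plus : ∀ {s} (p : P s) (p' : P (down s p)), down s (plus p p') = down (down s p) p'
  plus_root : ∀ {s} (p : P s), plus p (root (down s p)) = p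
  root_plus : ∀ {s} (p : P (down s (root s))),
    plus (root s) p = cast (congrArg P (down_root s)) p
  plus_assoc : ∀ {s} (p : P s) (p' : P (down s p)) (p'' : P (down s (plus p p'))),
    plus (plus p p') p'' = plus p (plus p' (cast (congrArg P (down_plus p p')) p''))

namespace DirectedContainer

/-- Directed container morphisms: a forward shape map `t` and a backward position map `q`. -/
@[ext]
structure Hom (E E' : DirectedContainer.{u}) : Type u where
  t : E.S → E'.S
  q : {s : E.S} → E'.P (t s) → E.P s
  map_down : ∀ {s} (p : E'.P (t s)), t (E.down s (q p)) = E'.down (t s) p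
  map_root : ∀ s, E.root s = q (E'.root (t s))
  map_plus : ∀ {s} (p : E'.P (t s)) (p' : E'.P (E'.down (t s) p)),
    E.plus (q p) (q (cast (congrArg E'.P (map_down p).symm) p')) = q (E'.plus p p')

/-- The identity morphism. -/
def Hom.id (E : DirectedContainer.{u}) : Hom E E where
  t s := s
  q p := p
  map_down _ := rfl
  map_root _ := rfl
  map_plus _ _ := rfl

theorem Hom.q_cast {E E' : DirectedContainer.{u}} (f : Hom E E') {s s' : E.S} (h : s = s')
    (h' : E'.P (f.t s) = E'.P (f.t s')) (p : E'.P (f.t s)) :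
    f.q (cast h' p) = cast (congrArg E.P h) (f.q p) := by
  subst h; rfl

/-- Composition, in diagrammatic order. -/
def Hom.comp {E E' E'' : DirectedContainer.{u}} (f : Hom E E') (g : Hom E' E'') : Hom E E'' where
  t s := g.t (f.t s)
  q p := f.q (g.q p)
  map_down p := by rw [f.map_down, g.map_down]
  map_root s := by rw [f.map_root, g.map_root]
  map_plus {s} p p' := by
    rw [← g.map_plus, ← f.map_plus, ← g.q_cast (f.map_down (g.q p)).symm]
    · rw [cast_cast]
    · rw [f.map_down]

/-- The category of directed containers. -/
instance : Category DirectedContainer.{u} where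
  Hom := Hom
  id := Hom.id
  comp := Hom.comp

/-! ### Interpretation as comonads on `Type u` -/

/-- The set functor `X ↦ Σ s : S, (P s → X)` of a container. -/
def containerFunctor (S : Type u) (P : S → Type u) : Type u ⥤ Type u where
  obj X := Σ s : S, (P s → X)
  map f := TypeCat.ofHom fun x => ⟨x.1, fun p => f (x.2 p)⟩

theorem sigma_fun_ext {S : Type u} {P : S → Type u} {X : Type u} {s s' : S} (h : s = s')
    {v : P s → X} {v' : P s' → X} (hv : ∀ p, v p = v' (cast (congrArg P h) p)) :
    (⟨s, v⟩ : Σ s : S, (P s → X)) = ⟨s', v'⟩ := by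
  subst h
  congr 1
  funext p
  exact hv p

/-- The comonad interpreting a directed container: the counit takes the datum at the root, the
comultiplication puts at each position the substructure there. -/
def toComonad (E : DirectedContainer.{u}) : Comonad (Type u) where
  toFunctor := containerFunctor E.S E.P
  ε := { app := fun X => TypeCat.ofHom fun (x : Σ s : E.S, (E.P s → X)) => x.2 (E.root x.1) }
  δ := { app := fun X => TypeCat.ofHom fun (x : Σ s : E.S, (E.P s → X)) =>
          (⟨x.1, fun p => ⟨E.down x.1 p, fun p' => x.2 (E.plus p p')⟩⟩ :
            Σ s : E.S, (E.P s → Σ s : E.S, (E.P s → X))) }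
  coassoc X := by
    ext ⟨s, v⟩
    refine sigma_fun_ext rfl fun p => ?_
    refine sigma_fun_ext rfl fun p' => ?_
    refine (sigma_fun_ext (P := E.P) (s := E.down s (E.plus p p'))
      (v := fun p'' => v (E.plus (E.plus p p') p'')) (E.down_plus p p') fun p'' => ?_).symm
    exact congrArg v (E.plus_assoc p p' p'')
  left_counit X := by
    ext ⟨s, v⟩
    exact sigma_fun_ext (E.down_root s) fun p => congrArg v (E.root_plus p)
  right_counit X := by
    ext ⟨s, v⟩
    exact sigma_fun_ext rfl fun p => congrArg v (E.plus_root p)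

/-- The comonad morphism `(s, v) ↦ (t s, v ∘ q)` interpreting a directed container morphism. -/
def Hom.toComonadHom {E E' : DirectedContainer.{u}} (f : Hom E E') :
    E.toComonad ⟶ E'.toComonad where
  app X := TypeCat.ofHom fun (x : Σ s : E.S, (E.P s → X)) =>
    (⟨f.t x.1, fun p => x.2 (f.q p)⟩ : Σ s : E'.S, (E'.P s → X))
  naturality _ _ _ := rfl
  app_ε X := by
    ext ⟨s, v⟩
    exact congrArg v (f.map_root s).symm
  app_δ X := by
    ext ⟨s, v⟩
    refine sigma_fun_ext rfl fun p => ?_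
    refine (sigma_fun_ext (f.map_down p) fun p' => ?_).symm
    refine congrArg v ?_
    refine Eq.trans ?_ (f.map_plus p _)
    rw [cast_cast]
    rfl

/-- The interpretation functor from directed containers to comonads on `Type u`. -/
def interpretation : DirectedContainer.{u} ⥤ Comonad (Type u) where
  obj := toComonad
  map f := Hom.toComonadHom f

end DirectedContainer

/-! ### Coideal comonads -/

/-- The functor `D X = X × D⁺ X`. -/
def coidealFunctor (F : Type u ⥤ Type u) : Type u ⥤ Type u where
  obj X := X × F.obj X
  map f := TypeCat.ofHom fun x => (f x.1, F.map f x.2)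

/-- The counit `ε = fst : D X → X`. -/
def coidealCounit (F : Type u ⥤ Type u) : coidealFunctor F ⟶ 𝟭 (Type u) where
  app X := TypeCat.ofHom fun (x : X × F.obj X) => x.1

/-- The comultiplication `δ = ⟨id, δ⁺ ∘ snd⟩ : D X → D X × D⁺ (D X)`. -/
def coidealComult (F : Type u ⥤ Type u) (d : F ⟶ coidealFunctor F ⋙ F) :
    coidealFunctor F ⟶ coidealFunctor F ⋙ coidealFunctor F where
  app X := TypeCat.ofHom fun (x : X × F.obj X) => (x, d.app X x.2)
  naturality X Y f := by
    ext z
    have h := ConcreteCategory.congr_hom (d.naturality f) z.2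
    exact Prod.ext rfl h

/-- A coideal comonad on `Type u`. -/
structure CoidealComonad : Type (u + 1) where
  Dplus : Type u ⥤ Type u
  δplus : Dplus ⟶ coidealFunctor Dplus ⋙ Dplus
  counit : ∀ X, δplus.app X ≫ Dplus.map ((coidealCounit Dplus).app X) = 𝟙 (Dplus.obj X)
  coassoc : ∀ X, δplus.app X ≫ Dplus.map ((coidealComult Dplus δplus).app X) =
    δplus.app X ≫ δplus.app ((coidealFunctor Dplus).obj X)

/-- The comonad given by a coideal comonad. -/
def CoidealComonad.toComonad (D : CoidealComonad.{u}) : Comonad (Type u) where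
  toFunctor := coidealFunctor D.Dplus
  ε := coidealCounit D.Dplus
  δ := coidealComult D.Dplus D.δplus
  coassoc X := by
    ext z
    have h := ConcreteCategory.congr_hom (D.coassoc X) z.2
    exact Prod.ext rfl h
  left_counit X := rfl
  right_counit X := by
    ext z
    have h := ConcreteCategory.congr_hom (D.counit X) z.2
    exact Prod.ext rfl h

/-! ### Strict directed containers -/

/-- A strict directed container: shapes `S`, non-root positions `P = P⁺`, and `↓⁺`, `⊕⁺`. -/
structure StrictDirectedContainer : Type (u + 1) where
  S : Type u
  P : S → Type u
  down : (s : S) → P s → S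
  plus : {s : S} → (p : P s) → P (down s p) → P s
  down_plus : ∀ {s} (p : P s) (p' : P (down s p)), down s (plus p p') = down (down s p) p'
  plus_assoc : ∀ {s} (p : P s) (p' : P (down s p)) (p'' : P (down s (plus p p'))),
    plus (plus p p') p'' = plus p (plus p' (cast (congrArg P (down_plus p p')) p''))

namespace StrictDirectedContainer

/-- Subshapes of the induced directed container; the position `none` is the root. -/
def downOpt (E : StrictDirectedContainer.{u}) (s : E.S) : Option (E.P s) → E.S
  | none => s
  | some p => E.down s p

/-- Translation of positions of the induced directed container. -/
def plusOpt (E : StrictDirectedContainer.{u}) {s : E.S} :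
    (p : Option (E.P s)) → Option (E.P (E.downOpt s p)) → Option (E.P s)
  | none, p' => p'
  | some p, none => some p
  | some p, some p' => some (E.plus p p')

theorem cast_none {A : Type u} {P : A → Type u} {a b : A} (h : a = b)
    (h' : Option (P a) = Option (P b)) : cast h' none = none := by
  subst h; rfl

theorem cast_some {A : Type u} {P : A → Type u} {a b : A} (h : a = b)
    (h' : Option (P a) = Option (P b)) (p : P a) :
    cast h' (some p) = some (cast (congrArg P h) p) := by
  subst h; rfl

theorem downOpt_plusOpt (E : StrictDirectedContainer.{u}) {s : E.S} (p : Option (E.P s))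
    (p' : Option (E.P (E.downOpt s p))) :
    E.downOpt s (E.plusOpt p p') = E.downOpt (E.downOpt s p) p' := by
  rcases p with _ | p
  · rfl
  · rcases p' with _ | p'
    · rfl
    · exact E.down_plus p p'

/-- The directed container induced by a strict directed container. -/
def toDirectedContainer (E : StrictDirectedContainer.{u}) : DirectedContainer.{u} where
  S := E.S
  P s := Option (E.P s)
  down := E.downOpt
  root _ := none
  plus := E.plusOpt
  down_root _ := rfl
  down_plus := E.downOpt_plusOpt
  plus_root p := by cases p <;> rfl
  root_plus _ := rfl
  plus_assoc {s} p p' p'' := by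
    rcases p with _ | p
    · rfl
    · rcases p' with _ | p'
      · rfl
      · rcases p'' with _ | p''
        · exact congrArg (E.plusOpt (some p)) (congrArg (E.plusOpt (some p'))
            (cast_none (P := E.P) (E.down_plus p p') _).symm)
        · refine Eq.trans (congrArg some (E.plus_assoc p p' p'')) ?_
          exact congrArg (E.plusOpt (some p)) (congrArg (E.plusOpt (some p'))
            (cast_some (P := E.P) (E.down_plus p p') _ p'').symm)

/-- The coideal comonad interpreting a strict directed container: `D⁺ X = Σ s, (P⁺ s → X)`, and `δ⁺`
puts at each non-root position the datum there together with its non-root substructure. -/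
def toCoidealComonad (E : StrictDirectedContainer.{u}) : CoidealComonad.{u} where
  Dplus := DirectedContainer.containerFunctor E.S E.P
  δplus := { app := fun X => TypeCat.ofHom fun (x : Σ s : E.S, (E.P s → X)) =>
      (⟨x.1, fun p => (x.2 p, ⟨E.down x.1 p, fun p' => x.2 (E.plus p p')⟩)⟩ :
        Σ s : E.S, (E.P s → X × Σ s : E.S, (E.P s → X))) }
  counit _ := rfl
  coassoc X := by
    ext ⟨s, v⟩
    refine DirectedContainer.sigma_fun_ext rfl fun p => ?_
    refine Prod.ext rfl ?_
    refine DirectedContainer.sigma_fun_ext rfl fun p' => ?_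
    refine Prod.ext rfl ?_
    refine (DirectedContainer.sigma_fun_ext (P := E.P) (s := E.down s (E.plus p p'))
      (v := fun p'' => v (E.plus (E.plus p p') p'')) (E.down_plus p p') fun p'' => ?_).symm
    exact congrArg v (E.plus_assoc p p' p'')

/-- The canonical bijection `(Σ s, (Option (P⁺ s) → X)) ≃ X × Σ s, (P⁺ s → X)`. -/
def sigmaOptionEquiv (E : StrictDirectedContainer.{u}) (X : Type u) :
    (Σ s : E.S, (Option (E.P s) → X)) ≃ X × Σ s : E.S, (E.P s → X) where
  toFun x := (x.2 none, ⟨x.1, fun p => x.2 (some p)⟩)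
  invFun y := ⟨y.2.1, fun p => p.elim y.1 y.2.2⟩
  left_inv x := DirectedContainer.sigma_fun_ext (P := fun s => Option (E.P s)) rfl
    fun p => by cases p <;> rfl
  right_inv _ := rfl

/-- The comonad interpreting the induced directed container is the interpreting coideal comonad, up
to the canonical isomorphism of comonads. -/
def coidealIso (E : StrictDirectedContainer.{u}) :
    E.toDirectedContainer.toComonad ≅ E.toCoidealComonad.toComonad :=
  ComonadIso.mk
    (NatIso.ofComponents (fun X => (E.sigmaOptionEquiv X).toIso) (fun _ => rfl))
    (fun _ => rfl)
    (fun _ => rfl)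

end StrictDirectedContainer

/-! ### The product construction -/

namespace StrictDirectedContainer

section Product

variable (E₀ E₁ : StrictDirectedContainer.{u})

/-- The final coalgebra obtained by eliminating the second of the two mutual components:
`ν Z. Σ s₀ : S₀, (P₀⁺ s₀ → Σ s₁ : S₁, (P₁⁺ s₁ → Z))`. -/
def AltTree : Type u :=
  (PFunctor.comp ⟨E₀.S, E₀.P⟩ ⟨E₁.S, E₁.P⟩ : PFunctor.{u, u}).M

/-- The second component of `ν (Z₀, Z₁). (Σ s₀ : S₀, (P₀⁺ s₀ → Z₁), Σ s₁ : S₁, (P₁⁺ s₁ → Z₀))`. -/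
def Shape₁ : Type u := Σ s₁ : E₁.S, (E₁.P s₁ → AltTree E₀ E₁)

/-- The first component of `ν (Z₀, Z₁). (Σ s₀ : S₀, (P₀⁺ s₀ → Z₁), Σ s₁ : S₁, (P₁⁺ s₁ → Z₀))`;
together with the second one it is a final coalgebra by `shape_final`. -/
def Shape₀ : Type u := Σ s₀ : E₀.S, (E₀.P s₀ → Shape₁ E₀ E₁)

variable {E₀ E₁}

/-- One step of unfolding. -/
def AltTree.unfold (m : AltTree E₀ E₁) : Shape₀ E₀ E₁ :=
  PFunctor.comp.get ⟨E₀.S, E₀.P⟩ ⟨E₁.S, E₁.P⟩ (PFunctor.M.dest m)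

/-- The map `v₀` of `s = (s₀, v₀)`. -/
def Shape₀.next (s : Shape₀ E₀ E₁) (p : E₀.P s.1) : Shape₁ E₀ E₁ := s.2 p

/-- The map `v₁` of `s = (s₁, v₁)`. -/
def Shape₁.next (s : Shape₁ E₀ E₁) (p : E₁.P s.1) : Shape₀ E₀ E₁ := (s.2 p).unfold

/-- First structure map `(s₀, v₀)` of the final coalgebra. -/
def Shape₀.out (s : Shape₀ E₀ E₁) : Σ s₀ : E₀.S, (E₀.P s₀ → Shape₁ E₀ E₁) := ⟨s.1, s.next⟩

/-- Second structure map `(s₁, v₁)` of the final coalgebra. -/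
def Shape₁.out (s : Shape₁ E₀ E₁) : Σ s₁ : E₁.S, (E₁.P s₁ → Shape₀ E₀ E₁) := ⟨s.1, s.next⟩

theorem AltTree.unfold_injective :
    Function.Injective (AltTree.unfold : AltTree E₀ E₁ → Shape₀ E₀ E₁) := by
  have hget : Function.Injective
      (fun x : (PFunctor.comp ⟨E₀.S, E₀.P⟩ ⟨E₁.S, E₁.P⟩ : PFunctor.{u, u}) (AltTree E₀ E₁) =>
        PFunctor.comp.get ⟨E₀.S, E₀.P⟩ ⟨E₁.S, E₁.P⟩ x) :=
    Function.LeftInverse.injective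
      (g := PFunctor.comp.mk ⟨E₀.S, E₀.P⟩ ⟨E₁.S, E₁.P⟩) (fun _ => rfl)
  intro m m' h
  have h' := hget h
  rw [← PFunctor.M.mk_dest m, ← PFunctor.M.mk_dest m']
  exact congrArg PFunctor.M.mk h'

/-- `(Shape₀, Shape₁)` is a final coalgebra of
`(Z₀, Z₁) ↦ (Σ s₀ : S₀, (P₀⁺ s₀ → Z₁), Σ s₁ : S₁, (P₁⁺ s₁ → Z₀))`. -/
theorem shape_final {X₀ X₁ : Type u} (c₀ : X₀ → Σ s₀ : E₀.S, (E₀.P s₀ → X₁))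
    (c₁ : X₁ → Σ s₁ : E₁.S, (E₁.P s₁ → X₀)) :
    ∃! f : (X₀ → Shape₀ E₀ E₁) × (X₁ → Shape₁ E₀ E₁),
      (∀ x, (f.1 x).out = ⟨(c₀ x).1, fun p => f.2 ((c₀ x).2 p)⟩) ∧
      (∀ x, (f.2 x).out = ⟨(c₁ x).1, fun p => f.1 ((c₁ x).2 p)⟩) := by
  let Q : PFunctor.{u, u} := PFunctor.comp ⟨E₀.S, E₀.P⟩ ⟨E₁.S, E₁.P⟩
  let g : X₀ → Q X₀ := fun x =>
    ⟨⟨(c₀ x).1, fun p => (c₁ ((c₀ x).2 p)).1⟩, fun b => (c₁ ((c₀ x).2 b.1)).2 b.2⟩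
  let k : X₀ → AltTree E₀ E₁ := PFunctor.M.corec g
  have hk : ∀ x, (k x).unfold =
      ⟨(c₀ x).1, fun p => ⟨(c₁ ((c₀ x).2 p)).1, fun p' => k ((c₁ ((c₀ x).2 p)).2 p')⟩⟩ := by
    intro x
    exact congrArg (PFunctor.comp.get ⟨E₀.S, E₀.P⟩ ⟨E₁.S, E₁.P⟩) (PFunctor.M.dest_corec g x)
  let f₁ : X₁ → Shape₁ E₀ E₁ := fun x => ⟨(c₁ x).1, fun p => k ((c₁ x).2 p)⟩
  refine ⟨(fun x => (k x).unfold, f₁), ⟨fun x => hk x, fun x => rfl⟩, ?_⟩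
  rintro ⟨a₀, a₁⟩ ⟨h₀, h₁⟩
  have key : ∀ x, ∃ m : AltTree E₀ E₁, m.unfold = a₀ x := fun x =>
    ⟨PFunctor.M.mk (PFunctor.comp.mk ⟨E₀.S, E₀.P⟩ ⟨E₁.S, E₁.P⟩ (a₀ x)), rfl⟩
  choose l hl using key
  have h₁' : ∀ x, a₁ x = ⟨(c₁ x).1, fun p => l ((c₁ x).2 p)⟩ := by
    intro x
    have h := h₁ x
    simp only [← hl] at h
    generalize a₁ x = y at h
    obtain ⟨y, w⟩ := y
    generalize c₁ x = z at h ⊢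
    obtain ⟨z, w'⟩ := z
    obtain rfl : y = z := congrArg Sigma.fst h
    have h2 := eq_of_heq (Sigma.mk.inj h).2
    congr 1
    funext p
    exact AltTree.unfold_injective (congrFun h2 p)
  have hlk : l = k := by
    refine PFunctor.M.corec_unique g l fun x => ?_
    have h : (l x).unfold = ⟨(c₀ x).1, fun p => a₁ ((c₀ x).2 p)⟩ := (hl x).trans (h₀ x)
    simp only [h₁'] at h
    exact congrArg (PFunctor.comp.mk ⟨E₀.S, E₀.P⟩ ⟨E₁.S, E₁.P⟩) h
  subst hlk
  exact Prod.ext (funext fun x => (hl x).symm) (funext h₁')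

mutual

/-- The first component of the initial algebra
`μ (Z₀, Z₁). (λ (s₀, v₀). Σ p₀, Maybe (Z₁ (v₀ p₀)), λ (s₁, v₁). Σ p₁, Maybe (Z₀ (v₁ p₁)))`:
`last p₀` is `(p₀, nothing)` and `cons p₀ p` is `(p₀, just p)`. -/
inductive Pos₀ : Shape₀ E₀ E₁ → Type u
  | last {s : Shape₀ E₀ E₁} (p₀ : E₀.P s.1) : Pos₀ s
  | cons {s : Shape₀ E₀ E₁} (p₀ : E₀.P s.1) (p : Pos₁ (s.next p₀)) : Pos₀ s

/-- The second component of that initial algebra. -/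
inductive Pos₁ : Shape₁ E₀ E₁ → Type u
  | last {s : Shape₁ E₀ E₁} (p₁ : E₁.P s.1) : Pos₁ s
  | cons {s : Shape₁ E₀ E₁} (p₁ : E₁.P s.1) (p : Pos₀ (s.next p₁)) : Pos₁ s

end

/-- Non-root positions of the product in the shape `(s₀, s₁)`. -/
def PosProd (s : Shape₀ E₀ E₁ × Shape₁ E₀ E₁) : Type u := Pos₀ s.1 ⊕ Pos₁ s.2

/-- `(s₀ ↓₀⁺ p₀, λ p. v₀ (p₀ ⊕₀⁺ p))`. -/
def Shape₀.sub (s : Shape₀ E₀ E₁) (p₀ : E₀.P s.1) : Shape₀ E₀ E₁ :=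
  ⟨E₀.down s.1 p₀, fun p => s.2 (E₀.plus p₀ p)⟩

/-- `(s₁ ↓₁⁺ p₁, λ p. v₁ (p₁ ⊕₁⁺ p))`. -/
def Shape₁.sub (s : Shape₁ E₀ E₁) (p₁ : E₁.P s.1) : Shape₁ E₀ E₁ :=
  ⟨E₁.down s.1 p₁, fun p => s.2 (E₁.plus p₁ p)⟩

mutual

/-- Subshape at a position starting in the first container. -/
def down₀ : (s : Shape₀ E₀ E₁) → Pos₀ s → Shape₀ E₀ E₁ × Shape₁ E₀ E₁
  | s, .last p₀ => (s.sub p₀, s.next p₀)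
  | s, .cons p₀ p => down₁ (s.next p₀) p

/-- Subshape at a position starting in the second container. -/
def down₁ : (s : Shape₁ E₀ E₁) → Pos₁ s → Shape₀ E₀ E₁ × Shape₁ E₀ E₁
  | s, .last p₁ => (s.next p₁, s.sub p₁)
  | s, .cons p₁ p => down₀ (s.next p₁) p

end

/-- The operation `↓⁺` of the product. -/
def downProd (s : Shape₀ E₀ E₁ × Shape₁ E₀ E₁) : PosProd s → Shape₀ E₀ E₁ × Shape₁ E₀ E₁
  | .inl p => down₀ s.1 p
  | .inr p => down₁ s.2 p

mutual

/-- Translation along a position starting in the first container. -/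
def plus₀ : {s : Shape₀ E₀ E₁} → (p : Pos₀ s) → PosProd (down₀ s p) → Pos₀ s
  | _, .last p₀, .inl (.last p₀') => .last (E₀.plus p₀ p₀')
  | _, .last p₀, .inl (.cons p₀' p₁') => .cons (E₀.plus p₀ p₀') p₁'
  | _, .last p₀, .inr p => .cons p₀ p
  | _, .cons p₀ p₁, p => .cons p₀ (plus₁ p₁ p)

/-- Translation along a position starting in the second container. -/
def plus₁ : {s : Shape₁ E₀ E₁} → (p : Pos₁ s) → PosProd (down₁ s p) → Pos₁ s
  | _, .last p₁, .inr (.last p₁') => .last (E₁.plus p₁ p₁')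
  | _, .last p₁, .inr (.cons p₁' p₀') => .cons (E₁.plus p₁ p₁') p₀'
  | _, .last p₁, .inl p => .cons p₁ p
  | _, .cons p₁ p₀, p => .cons p₁ (plus₀ p₀ p)

end

/-- The operation `⊕⁺` of the product. -/
def plusProd {s : Shape₀ E₀ E₁ × Shape₁ E₀ E₁} :
    (p : PosProd s) → PosProd (downProd s p) → PosProd s
  | .inl p, p' => .inl (plus₀ p p')
  | .inr p, p' => .inr (plus₁ p p')

theorem Shape₀.sub_plus (s : Shape₀ E₀ E₁) (p : E₀.P s.1) (p' : E₀.P (E₀.down s.1 p)) :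
    s.sub (E₀.plus p p') = (s.sub p).sub p' :=
  DirectedContainer.sigma_fun_ext (P := E₀.P) (X := Shape₁ E₀ E₁) (E₀.down_plus p p')
    fun p'' => congrArg s.2 (E₀.plus_assoc p p' p'')

theorem Shape₁.sub_plus (s : Shape₁ E₀ E₁) (p : E₁.P s.1) (p' : E₁.P (E₁.down s.1 p)) :
    s.sub (E₁.plus p p') = (s.sub p).sub p' :=
  DirectedContainer.sigma_fun_ext (P := E₁.P) (X := AltTree E₀ E₁) (E₁.down_plus p p')
    fun p'' => congrArg s.2 (E₁.plus_assoc p p' p'')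

mutual

theorem down_plus₀ : ∀ {s : Shape₀ E₀ E₁} (p : Pos₀ s) (p' : PosProd (down₀ s p)),
    down₀ s (plus₀ p p') = downProd (down₀ s p) p'
  | s, .last p₀, .inl (.last p₀') => Prod.ext (s.sub_plus p₀ p₀') rfl
  | _, .last _, .inl (.cons _ _) => rfl
  | _, .last _, .inr _ => rfl
  | _, .cons _ p₁, p' => down_plus₁ p₁ p'

theorem down_plus₁ : ∀ {s : Shape₁ E₀ E₁} (p : Pos₁ s) (p' : PosProd (down₁ s p)),
    down₁ s (plus₁ p p') = downProd (down₁ s p) p'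
  | s, .last p₁, .inr (.last p₁') => Prod.ext rfl (s.sub_plus p₁ p₁')
  | _, .last _, .inr (.cons _ _) => rfl
  | _, .last _, .inl _ => rfl
  | _, .cons _ p₀, p' => down_plus₀ p₀ p'

end

theorem downProd_plusProd {s : Shape₀ E₀ E₁ × Shape₁ E₀ E₁} (p : PosProd s)
    (p' : PosProd (downProd s p)) :
    downProd s (plusProd p p') = downProd (downProd s p) p' := by
  rcases p with p | p
  · exact down_plus₀ p p'
  · exact down_plus₁ p p'

theorem cast_inl {s t : Shape₀ E₀ E₁ × Shape₁ E₀ E₁} (h : s = t) (h' : PosProd s = PosProd t)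
    (p : Pos₀ s.1) : cast h' (.inl p) = .inl (cast (congrArg (fun z => Pos₀ z.1) h) p) := by
  subst h; rfl

theorem cast_inr {s t : Shape₀ E₀ E₁ × Shape₁ E₀ E₁} (h : s = t) (h' : PosProd s = PosProd t)
    (p : Pos₁ s.2) : cast h' (.inr p) = .inr (cast (congrArg (fun z => Pos₁ z.2) h) p) := by
  subst h; rfl

theorem cast_last₀ {x y : Shape₀ E₀ E₁} (h : x = y) (h' : Pos₀ x = Pos₀ y) (p : E₀.P x.1) :
    cast h' (.last p) = .last (cast (congrArg (fun z => E₀.P z.1) h) p) := by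
  subst h; rfl

theorem cast_last₁ {x y : Shape₁ E₀ E₁} (h : x = y) (h' : Pos₁ x = Pos₁ y) (p : E₁.P x.1) :
    cast h' (.last p) = .last (cast (congrArg (fun z => E₁.P z.1) h) p) := by
  subst h; rfl

theorem cast_cons₀ {x y : Shape₀ E₀ E₁} (h : x = y) (h' : Pos₀ x = Pos₀ y) (p : E₀.P x.1)
    (r : Pos₁ (x.next p)) : ∃ r', r ≍ r' ∧
      cast h' (.cons p r) = .cons (cast (congrArg (fun z => E₀.P z.1) h) p) r' := by
  subst h; exact ⟨r, HEq.rfl, rfl⟩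

theorem cast_cons₁ {x y : Shape₁ E₀ E₁} (h : x = y) (h' : Pos₁ x = Pos₁ y) (p : E₁.P x.1)
    (r : Pos₀ (x.next p)) : ∃ r', r ≍ r' ∧
      cast h' (.cons p r) = .cons (cast (congrArg (fun z => E₁.P z.1) h) p) r' := by
  subst h; exact ⟨r, HEq.rfl, rfl⟩

theorem cons_congr₀ {s : Shape₀ E₀ E₁} {p p' : E₀.P s.1} (h : p = p') {r : Pos₁ (s.next p)}
    {r' : Pos₁ (s.next p')} (hr : r ≍ r') : Pos₀.cons p r = Pos₀.cons p' r' := by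
  subst h; rw [eq_of_heq hr]

theorem cons_congr₁ {s : Shape₁ E₀ E₁} {p p' : E₁.P s.1} (h : p = p') {r : Pos₀ (s.next p)}
    {r' : Pos₀ (s.next p')} (hr : r ≍ r') : Pos₁.cons p r = Pos₁.cons p' r' := by
  subst h; rw [eq_of_heq hr]

mutual

theorem plus_assoc₀ : ∀ {s : Shape₀ E₀ E₁} (p : Pos₀ s) (p' : PosProd (down₀ s p))
    (p'' : PosProd (down₀ s (plus₀ p p'))),
    plus₀ (plus₀ p p') p'' =
      plus₀ p (plusProd p' (cast (congrArg PosProd (down_plus₀ p p')) p''))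
  | s, .last p₀, .inl (.last p₀'), .inl (.last q) => by
    rw [cast_inl (down_plus₀ (s := s) (.last p₀) (.inl (.last p₀'))),
      cast_last₀ (congrArg Prod.fst (down_plus₀ (s := s) (.last p₀) (.inl (.last p₀'))))]
    exact congrArg Pos₀.last (E₀.plus_assoc p₀ p₀' q)
  | s, .last p₀, .inl (.last p₀'), .inl (.cons q r) => by
    rw [cast_inl (down_plus₀ (s := s) (.last p₀) (.inl (.last p₀')))]
    obtain ⟨r', hr, hc⟩ := cast_cons₀
      (congrArg Prod.fst (down_plus₀ (s := s) (.last p₀) (.inl (.last p₀'))))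
      (congrArg (fun z => Pos₀ z.1) (down_plus₀ (s := s) (.last p₀) (.inl (.last p₀')))) q r
    rw [hc]
    exact cons_congr₀ (E₀.plus_assoc p₀ p₀' q) hr
  | s, .last p₀, .inl (.last p₀'), .inr r => by
    rw [cast_inr (down_plus₀ (s := s) (.last p₀) (.inl (.last p₀')))]
    rfl
  | _, .last _, .inl (.cons _ _), _ => rfl
  | _, .last _, .inr _, _ => rfl
  | _, .cons p₀ p₁, p', p'' => congrArg (Pos₀.cons p₀) (plus_assoc₁ p₁ p' p'')

theorem plus_assoc₁ : ∀ {s : Shape₁ E₀ E₁} (p : Pos₁ s) (p' : PosProd (down₁ s p))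
    (p'' : PosProd (down₁ s (plus₁ p p'))),
    plus₁ (plus₁ p p') p'' =
      plus₁ p (plusProd p' (cast (congrArg PosProd (down_plus₁ p p')) p''))
  | s, .last p₁, .inr (.last p₁'), .inr (.last q) => by
    rw [cast_inr (down_plus₁ (s := s) (.last p₁) (.inr (.last p₁'))),
      cast_last₁ (congrArg Prod.snd (down_plus₁ (s := s) (.last p₁) (.inr (.last p₁'))))]
    exact congrArg Pos₁.last (E₁.plus_assoc p₁ p₁' q)
  | s, .last p₁, .inr (.last p₁'), .inr (.cons q r) => by
    rw [cast_inr (down_plus₁ (s := s) (.last p₁) (.inr (.last p₁')))]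
    obtain ⟨r', hr, hc⟩ := cast_cons₁
      (congrArg Prod.snd (down_plus₁ (s := s) (.last p₁) (.inr (.last p₁'))))
      (congrArg (fun z => Pos₁ z.2) (down_plus₁ (s := s) (.last p₁) (.inr (.last p₁')))) q r
    rw [hc]
    exact cons_congr₁ (E₁.plus_assoc p₁ p₁' q) hr
  | s, .last p₁, .inr (.last p₁'), .inl r => by
    rw [cast_inl (down_plus₁ (s := s) (.last p₁) (.inr (.last p₁')))]
    rfl
  | _, .last _, .inr (.cons _ _), _ => rfl
  | _, .last _, .inl _, _ => rfl
  | _, .cons p₁ p₀, p', p'' => congrArg (Pos₁.cons p₁) (plus_assoc₀ p₀ p' p'')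

end

/-- The product `E` of two strict directed containers. -/
def prod (E₀ E₁ : StrictDirectedContainer.{u}) : StrictDirectedContainer.{u} where
  S := Shape₀ E₀ E₁ × Shape₁ E₀ E₁
  P := PosProd
  down := downProd
  plus := plusProd
  down_plus := downProd_plusProd
  plus_assoc p p' p'' := by
    rcases p with p | p
    · exact congrArg Sum.inl (plus_assoc₀ p p' p'')
    · exact congrArg Sum.inr (plus_assoc₁ p p' p'')

end Product

end StrictDirectedContainer

/-!
A comonad morphism `G ⟶ D` amounts to a way of turning `G`-coalgebras into `D`-coalgebras on the
same objects. Applied to the cofree coalgebras this gives `nonempty_isLimit_of_coalgebra`: a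
comonad `D` over `D₀` and `D₁` is their product as soon as a `D`-coalgebra is the same thing as a
pair of a `D₀`-coalgebra and a `D₁`-coalgebra on the same object, for objects as well as for
morphisms. This reduces the product property against arbitrary comonads to a statement about sets.

A coalgebra of the comonad interpreting a strict directed container `E` is an action of `E`
(`StrictDirectedContainer.Action`): every element `a` has a shape, and for each non-root position
`p` of that shape there is an element `a / p`, with `(a / p) / p' = a / (p ⊕⁺ p')`. Two actions of
`E₀` and `E₁` on a set `A` are the same as one action of the product. The shapes `A → Shape₀`, `A
→ Shape₁` come from finality, applied to the steps `a ↦ a / p₀` and `a ↦ a / p₁`, and a position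
of the product is an alternating word of positions of `E₀` and `E₁`, along which the two actions
are applied in turn (`ActionPair.action`). Conversely, an action of the product is determined by
its values at words of length one: shapes by the uniqueness part of finality, elements by
induction on positions (`PreservesLetters.isCoalgebraHom`).

Directed containers inherit the product property because the interpretation functor is fully
faithful (`DirectedContainer.interpretationFullyFaithful`), hence reflects limits, and the coideal
comonads inherit it along the canonical isomorphisms.
-/

/-! ### Products of comonads, detected on coalgebras -/

section ComonadProduct

universe v w

variable {C : Type w} [Category.{v} C]

/-- `θ` is the structure map of a coalgebra of the comonad `D`. This is the unbundled form of
`Comonad.Coalgebra`, used because coalgebra structures of several comonads on the same object have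
to be compared. -/
structure IsCoalgebra (D : Comonad C) {A : C} (θ : A ⟶ D.obj A) : Prop where
  counit : θ ≫ D.ε.app A = 𝟙 A
  coassoc : θ ≫ D.δ.app A = θ ≫ D.map θ

/-- `h` is a morphism from the coalgebra `θ` to the coalgebra `θ'`. -/
def IsCoalgebraHom (D : Comonad C) {A B : C} (θ : A ⟶ D.obj A) (θ' : B ⟶ D.obj B) (h : A ⟶ B) :
    Prop :=
  θ ≫ D.map h = h ≫ θ'

theorem IsCoalgebra.cofree (G : Comonad C) (X : C) : IsCoalgebra G (G.δ.app X) :=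
  ⟨G.left_counit X, (G.coassoc X).symm⟩

theorem IsCoalgebraHom.cofree_map (G : Comonad C) {X Y : C} (f : X ⟶ Y) :
    IsCoalgebraHom G (G.δ.app X) (G.δ.app Y) (G.map f) :=
  (G.δ.naturality f).symm

theorem IsCoalgebraHom.cofree_comult (G : Comonad C) (X : C) :
    IsCoalgebraHom G (G.δ.app X) (G.δ.app (G.obj X)) (G.δ.app X) :=
  G.coassoc X

theorem IsCoalgebra.comp {G D : Comonad C} (f : G ⟶ D) {A : C} {θ : A ⟶ G.obj A}
    (hθ : IsCoalgebra G θ) : IsCoalgebra D (θ ≫ f.app A) where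
  counit := by rw [Category.assoc, f.app_ε, hθ.counit]
  coassoc := by
    rw [Category.assoc, f.app_δ, ← Category.assoc, hθ.coassoc, D.map_comp, Category.assoc,
      Category.assoc]
    have h := f.naturality θ
    simp only [← Category.assoc]
    simp only [Category.assoc] at h ⊢
    rw [reassoc_of% h]

theorem IsCoalgebraHom.comp {G D : Comonad C} (f : G ⟶ D) {A B : C} {θ : A ⟶ G.obj A}
    {θ' : B ⟶ G.obj B} {h : A ⟶ B} (hh : IsCoalgebraHom G θ θ' h) :
    IsCoalgebraHom D (θ ≫ f.app A) (θ' ≫ f.app B) h := by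
  unfold IsCoalgebraHom at *
  rw [Category.assoc, ← f.naturality h, ← Category.assoc, hh, Category.assoc]

/-- Every comonad morphism is recovered from its effect on cofree coalgebras. -/
theorem app_eq_cofree {G D : Comonad C} (f : G ⟶ D) (X : C) :
    f.app X = (G.δ.app X ≫ f.app (G.obj X)) ≫ D.map (G.ε.app X) := by
  rw [Category.assoc, ← f.naturality (G.ε.app X), ← Category.assoc]
  exact (((G.right_counit X).symm ▸ Category.id_comp (f.app X) :
    (G.δ.app X ≫ G.map (G.ε.app X)) ≫ f.app X = f.app X)).symm

/-- A choice of `D`-coalgebra structures on the cofree `G`-coalgebras, natural in the morphisms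
`G.map f` and `G.δ.app X` between them, gives a morphism of comonads. -/
def comonadHomOfCofree {G D : Comonad C} (θ : ∀ X, G.obj X ⟶ D.obj (G.obj X))
    (hθ : ∀ X, IsCoalgebra D (θ X))
    (hmap : ∀ {X Y : C} (f : X ⟶ Y), IsCoalgebraHom D (θ X) (θ Y) (G.map f))
    (hδ : ∀ X, IsCoalgebraHom D (θ X) (θ (G.obj X)) (G.δ.app X)) : G ⟶ D where
  app X := θ X ≫ D.map (G.ε.app X)
  naturality X Y f := by
    have h := hmap f
    unfold IsCoalgebraHom at h
    have e : G.map f ≫ G.ε.app Y = G.ε.app X ≫ f := G.ε.naturality f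
    rw [← Category.assoc, ← h, Category.assoc, Category.assoc]
    erw [← D.map_comp, ← D.map_comp, e]
  app_ε X := by
    have e : D.map (G.ε.app X) ≫ D.ε.app X = D.ε.app (G.obj X) ≫ G.ε.app X := D.ε.naturality _
    rw [Category.assoc, e, ← Category.assoc, (hθ X).counit, Category.id_comp]
  app_δ X := by
    have e : D.map (G.ε.app X) ≫ D.δ.app X = D.δ.app (G.obj X) ≫ D.map (D.map (G.ε.app X)) :=
      D.δ.naturality _
    have h : θ X ≫ D.map (G.δ.app X) = G.δ.app X ≫ θ (G.obj X) := hδ X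
    rw [Category.assoc, e, ← Category.assoc, (hθ X).coassoc, Category.assoc, ← D.map_comp,
      ← Category.assoc (G.δ.app X), ← Category.assoc (G.δ.app X), ← h, Category.assoc,
      Category.assoc, ← Category.assoc (D.map (G.δ.app X))]
    have r : D.map (G.δ.app X) ≫ D.map (G.ε.app (G.obj X)) = 𝟙 _ := by
      rw [← D.map_comp, G.left_counit, D.map_id]
    erw [r]
    rw [Category.id_comp]

/-- `D` with `π₀` and `π₁` is a product of comonads as soon as its category of coalgebras is the
pullback, over the base category, of those of `D₀` and `D₁`: `lift` is surjectivity on objects of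
the comparison functor, and `hom` is its fullness, which for `h = 𝟙` includes injectivity on
objects. -/
theorem nonempty_isLimit_of_coalgebra {D D₀ D₁ : Comonad C} (π₀ : D ⟶ D₀) (π₁ : D ⟶ D₁)
    (lift : ∀ {A : C} (θ₀ : A ⟶ D₀.obj A) (θ₁ : A ⟶ D₁.obj A), IsCoalgebra D₀ θ₀ →
      IsCoalgebra D₁ θ₁ → ∃ θ : A ⟶ D.obj A, IsCoalgebra D θ ∧
        θ ≫ π₀.app A = θ₀ ∧ θ ≫ π₁.app A = θ₁)
    (hom : ∀ {A B : C} (θ : A ⟶ D.obj A) (θ' : B ⟶ D.obj B) (h : A ⟶ B), IsCoalgebra D θ →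
      IsCoalgebra D θ' → IsCoalgebraHom D₀ (θ ≫ π₀.app A) (θ' ≫ π₀.app B) h →
      IsCoalgebraHom D₁ (θ ≫ π₁.app A) (θ' ≫ π₁.app B) h → IsCoalgebraHom D θ θ' h) :
    Nonempty (IsLimit (BinaryFan.mk π₀ π₁)) := by
  -- The mediating morphism comes from the `D`-coalgebras lifting the pairs of coalgebras that `f₀`
  -- and `f₁` induce on the cofree ones.
  have ex : ∀ {G : Comonad C} (f₀ : G ⟶ D₀) (f₁ : G ⟶ D₁),
      ∃ α : G ⟶ D, α ≫ π₀ = f₀ ∧ α ≫ π₁ = f₁ := by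
    intro G f₀ f₁
    choose θ hθ h₀ h₁ using fun X => lift (G.δ.app X ≫ f₀.app (G.obj X))
      (G.δ.app X ≫ f₁.app (G.obj X)) ((IsCoalgebra.cofree G X).comp f₀)
      ((IsCoalgebra.cofree G X).comp f₁)
    have key : ∀ {X Y : C} (h : G.obj X ⟶ G.obj Y),
        IsCoalgebraHom G (G.δ.app X) (G.δ.app Y) h → IsCoalgebraHom D (θ X) (θ Y) h := by
      intro X Y h hh
      refine hom _ _ _ (hθ X) (hθ Y) ?_ ?_
      · rw [h₀, h₀]; exact hh.comp f₀
      · rw [h₁, h₁]; exact hh.comp f₁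
    refine ⟨comonadHomOfCofree θ hθ (fun f => key _ (.cofree_map G f))
      (fun X => key _ (.cofree_comult G X)), ?_, ?_⟩
    · ext X
      refine Eq.trans ?_ (app_eq_cofree f₀ X).symm
      rw [← h₀, Category.assoc, ← π₀.naturality, ← Category.assoc]
      rfl
    · ext X
      refine Eq.trans ?_ (app_eq_cofree f₁ X).symm
      rw [← h₁, Category.assoc, ← π₁.naturality, ← Category.assoc]
      rfl
  have uniq : ∀ {G : Comonad C} (α β : G ⟶ D), α ≫ π₀ = β ≫ π₀ → α ≫ π₁ = β ≫ π₁ → α = β := by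
    intro G α β e₀ e₁
    ext X
    rw [app_eq_cofree α, app_eq_cofree β]
    congr 1
    have e₀' : α.app (G.obj X) ≫ π₀.app _ = β.app (G.obj X) ≫ π₀.app _ :=
      congrArg (fun γ : G ⟶ D₀ => γ.app (G.obj X)) e₀
    have e₁' : α.app (G.obj X) ≫ π₁.app _ = β.app (G.obj X) ≫ π₁.app _ :=
      congrArg (fun γ : G ⟶ D₁ => γ.app (G.obj X)) e₁
    -- Two structures on the same object agree if the identity is a morphism between them.
    have h := hom (G.δ.app X ≫ α.app _) (G.δ.app X ≫ β.app _) (𝟙 (G.obj X))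
      ((IsCoalgebra.cofree G X).comp α) ((IsCoalgebra.cofree G X).comp β)
      (by rw [IsCoalgebraHom, D₀.map_id, Category.comp_id, Category.id_comp, Category.assoc, e₀',
            Category.assoc])
      (by rw [IsCoalgebraHom, D₁.map_id, Category.comp_id, Category.id_comp, Category.assoc, e₁',
            Category.assoc])
    rwa [IsCoalgebraHom, D.map_id, Category.id_comp, Category.comp_id] at h
  choose l hl₀ hl₁ using @ex
  exact ⟨BinaryFan.isLimitMk (fun s => l s.fst s.snd) (fun s => hl₀ _ _) (fun s => hl₁ _ _)
    fun s m e₀ e₁ => uniq _ _ (e₀.trans (hl₀ _ _).symm) (e₁.trans (hl₁ _ _).symm)⟩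

end ComonadProduct

/-! ### The interpretation functor is fully faithful -/

namespace DirectedContainer

theorem sigma_fun_inj {S : Type u} {P : S → Type u} {X : Type u} {s s' : S} {v : P s → X}
    {v' : P s' → X} (h : (⟨s, v⟩ : Σ s : S, (P s → X)) = ⟨s', v'⟩) :
    ∃ e : s = s', ∀ p, v p = v' (cast (congrArg P e) p) := by
  cases h
  exact ⟨rfl, fun _ => rfl⟩

/-- The structure of shape `s` with data `v`, as an element of the interpretation of `E`. -/
def structureOf (E : DirectedContainer.{u}) {X : Type u} (s : E.S) (v : E.P s → X) :
    E.toComonad.obj X :=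
  (⟨s, v⟩ : Σ s : E.S, (E.P s → X))

/-- The value of a comonad morphism at the generic structure of shape `s`, in which each position
is its own datum. -/
def generic {E E' : DirectedContainer.{u}} (α : E.toComonad ⟶ E'.toComonad) (s : E.S) :
    Σ s' : E'.S, (E'.P s' → E.P s) :=
  α.app (E.P s) (E.structureOf (X := E.P s) s fun p => p)

theorem app_eq_generic {E E' : DirectedContainer.{u}} (α : E.toComonad ⟶ E'.toComonad) {X : Type u}
    (s : E.S) (v : E.P s → X) :
    (α.app X (E.structureOf s v) : Σ s' : E'.S, (E'.P s' → X)) =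
      ⟨(generic α s).1, fun p => v ((generic α s).2 p)⟩ :=
  ConcreteCategory.congr_hom (α.naturality (TypeCat.ofHom v))
    (E.structureOf (X := E.P s) s fun p => p)

/-- Preservation of the comultiplication, evaluated at the generic structure. -/
theorem generic_down_plus {E E' : DirectedContainer.{u}} (α : E.toComonad ⟶ E'.toComonad)
    {s : E.S} (p : E'.P (generic α s).1) :
    ∃ e : E'.down (generic α s).1 p = (generic α (E.down s ((generic α s).2 p))).1,
      ∀ p', (generic α s).2 (E'.plus p p') =
        E.plus ((generic α s).2 p) ((generic α _).2 (cast (congrArg E'.P e) p')) := by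
  have h := ConcreteCategory.congr_hom (α.app_δ (E.P s))
    (E.structureOf (X := E.P s) s fun p => p)
  have h' : (⟨(generic α s).1, fun p => ⟨E'.down (generic α s).1 p,
        fun p' => (generic α s).2 (E'.plus p p')⟩⟩ :
        Σ s' : E'.S, (E'.P s' → Σ s' : E'.S, (E'.P s' → E.P s))) =
      ⟨(generic α s).1, fun p => ⟨(generic α (E.down s ((generic α s).2 p))).1,
        fun p' => E.plus ((generic α s).2 p) ((generic α _).2 p')⟩⟩ := by
    refine h.trans ?_
    change (E'.toComonad.map (α.app (E.P s))) (α.app _ (E.structureOf s fun p =>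
      E.structureOf (E.down s p) fun p' => E.plus p p')) = _
    rw [app_eq_generic]
    refine sigma_fun_ext rfl fun p => ?_
    exact app_eq_generic α _ _
  exact sigma_fun_inj (congrFun (eq_of_heq (Sigma.mk.inj h').2) p)

/-- The directed container morphism underlying a comonad morphism. -/
def homOfComonadHom {E E' : DirectedContainer.{u}} (α : E.toComonad ⟶ E'.toComonad) :
    Hom E E' where
  t s := (generic α s).1
  q {s} p := (generic α s).2 p
  map_down p := (generic_down_plus α p).1.symm
  map_root s := (ConcreteCategory.congr_hom (α.app_ε (E.P s))
    (E.structureOf (X := E.P s) s fun p => p)).symm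
  map_plus p p' := ((generic_down_plus α p).2 p').symm

theorem toComonadHom_homOfComonadHom {E E' : DirectedContainer.{u}}
    (α : E.toComonad ⟶ E'.toComonad) : (homOfComonadHom α).toComonadHom = α := by
  refine ComonadHom.ext' _ _ (funext fun X => ?_)
  ext ⟨s, v⟩
  exact (app_eq_generic α s v).symm

theorem homOfComonadHom_toComonadHom {E E' : DirectedContainer.{u}} (f : Hom E E') :
    homOfComonadHom f.toComonadHom = f := rfl

/-- A comonad morphism between interpretations of directed containers is, by the Yoneda argument,
determined by its values at the generic structures, which form a directed container morphism. -/
def interpretationFullyFaithful : interpretation.{u}.FullyFaithful where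
  preimage α := homOfComonadHom α
  map_preimage α := toComonadHom_homOfComonadHom α
  preimage_map f := homOfComonadHom_toComonadHom f

end DirectedContainer

/-! ### Coalgebras of an interpreted strict directed container -/

namespace StrictDirectedContainer

/-- An action of `E` on the set `A`: every element has a shape, and an element at each non-root
position of that shape, compatibly with `↓⁺` and `⊕⁺`. The shape `s` in `sub` is a variable
constrained by an equation, so that the laws need no transport along equalities of shapes. -/
structure Action (E : StrictDirectedContainer.{u}) (A : Type u) where
  shape : A → E.S
  sub : (a : A) → {s : E.S} → shape a = s → E.P s → A
  shape_sub : ∀ (a : A) {s : E.S} (h : shape a = s) (p : E.P s), shape (sub a h p) = E.down s p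
  sub_sub : ∀ (a : A) {s : E.S} (h : shape a = s) (p : E.P s) (p' : E.P (E.down s p)),
    sub (sub a h p) (shape_sub a h p) p' = sub a h (E.plus p p')

namespace Action

variable {E : StrictDirectedContainer.{u}} {A B : Type u}

/-- The value at an arbitrary position, the one at the root being the element itself. -/
def subOpt (T : E.Action A) (a : A) : Option (E.P (T.shape a)) → A
  | none => a
  | some p => T.sub a rfl p

/-- The coalgebra of the comonad interpreting `E` given by an action of `E`. -/
def toCoalgebra (T : E.Action A) : A ⟶ E.toDirectedContainer.toComonad.obj A :=
  TypeCat.ofHom fun a =>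
    (⟨T.shape a, T.subOpt a⟩ : Σ s : E.S, (Option (E.P s) → A))

theorem sub_congr (T : E.Action A) {a a' : A} (e : a = a') {s s' : E.S} (h : T.shape a = s)
    (h' : T.shape a' = s') {p : E.P s} {p' : E.P s'} (hp : p ≍ p') :
    T.sub a h p = T.sub a' h' p' := by
  subst e; subst h; subst h'; rw [eq_of_heq hp]

theorem isCoalgebra (T : E.Action A) :
    IsCoalgebra E.toDirectedContainer.toComonad T.toCoalgebra where
  counit := rfl
  coassoc := by
    ext a
    refine DirectedContainer.sigma_fun_ext (P := fun s => Option (E.P s)) rfl fun p => ?_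
    rcases p with _ | p
    · refine DirectedContainer.sigma_fun_ext (P := fun s => Option (E.P s)) rfl fun p => ?_
      cases p <;> rfl
    · refine DirectedContainer.sigma_fun_ext (P := fun s => Option (E.P s))
        (T.shape_sub a rfl p).symm fun p' => ?_
      rcases p' with _ | p'
      · rw [cast_none (P := E.P) (T.shape_sub a rfl p).symm]
        rfl
      · rw [cast_some (P := E.P) (T.shape_sub a rfl p).symm]
        refine (T.sub_sub a rfl p p').symm.trans ?_
        exact T.sub_congr rfl _ _ (cast_heq _ _).symm

/-- Every coalgebra of the comonad interpreting `E` comes from an action of `E`. -/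
theorem exists_toCoalgebra_eq (θ : A ⟶ E.toDirectedContainer.toComonad.obj A)
    (hθ : IsCoalgebra E.toDirectedContainer.toComonad θ) : ∃ T : E.Action A, T.toCoalgebra = θ := by
  let sh : A → E.S := fun a => (θ a : Σ s : E.S, (Option (E.P s) → A)).1
  let v : (a : A) → Option (E.P (sh a)) → A :=
    fun a => (θ a : Σ s : E.S, (Option (E.P s) → A)).2
  have hv : ∀ a, v a none = a := fun a => ConcreteCategory.congr_hom hθ.counit a
  have key : ∀ a (p : Option (E.P (sh a))), ∃ e : E.downOpt (sh a) p = sh (v a p),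
      ∀ p', v a (E.plusOpt p p') = v (v a p) (cast (congrArg (fun s => Option (E.P s)) e) p') := by
    intro a p
    have h := ConcreteCategory.congr_hom hθ.coassoc a
    have h' : (⟨sh a, fun p => ⟨E.downOpt (sh a) p, fun p' => v a (E.plusOpt p p')⟩⟩ :
        Σ s : E.S, (Option (E.P s) → Σ s : E.S, (Option (E.P s) → A))) =
        ⟨sh a, fun p => ⟨sh (v a p), v (v a p)⟩⟩ := h
    exact DirectedContainer.sigma_fun_inj (P := fun s => Option (E.P s))
      (congrFun (eq_of_heq (Sigma.mk.inj h').2) p)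
  have hsub : ∀ a {s : E.S} (h : sh a = s) (p : E.P s),
      sh (v a (some (cast (congrArg E.P h.symm) p))) = E.down s p := by
    intro a s h p
    subst h
    exact (key a (some p)).1.symm
  refine ⟨⟨sh, fun a s h p => v a (some (cast (congrArg E.P h.symm) p)), hsub, ?_⟩, ?_⟩
  · intro a s h p p'
    subst h
    exact (((key a (some p)).2 (some p')).trans
      (congrArg (v _) (cast_some (P := E.P) (key a (some p)).1 _ p'))).symm
  · ext a
    refine DirectedContainer.sigma_fun_ext (P := fun s => Option (E.P s)) rfl fun p => ?_
    rcases p with _ | p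
    · exact (hv a).symm
    · rfl

/-- A map preserving shapes and elements at positions is a morphism of coalgebras. -/
theorem isCoalgebraHom (T : E.Action A) (T' : E.Action B) (h : A → B)
    (H : ∀ a, ∃ e : T'.shape (h a) = T.shape a, ∀ p, T'.sub (h a) e p = h (T.sub a rfl p)) :
    IsCoalgebraHom E.toDirectedContainer.toComonad T.toCoalgebra T'.toCoalgebra
      (TypeCat.ofHom h) := by
  ext a
  obtain ⟨e, he⟩ := H a
  refine DirectedContainer.sigma_fun_ext (P := fun s => Option (E.P s)) e.symm fun p => ?_
  rcases p with _ | p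
  · rw [cast_none (P := E.P) e.symm]
    rfl
  · rw [cast_some (P := E.P) e.symm]
    exact (he p).symm.trans (T'.sub_congr rfl _ _ (cast_heq _ _).symm)

end Action

end StrictDirectedContainer

/-! ### Actions of the product -/

namespace StrictDirectedContainer

variable {E₀ E₁ : StrictDirectedContainer.{u}} {A B : Type u}

theorem Shape₁.out_injective {x y : Shape₁ E₀ E₁} (h : x.out = y.out) : x = y := by
  obtain ⟨s, v⟩ := x
  obtain ⟨s', v'⟩ := y
  obtain ⟨e, he⟩ := DirectedContainer.sigma_fun_inj h
  dsimp only at e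
  subst e
  exact congrArg (Sigma.mk _) (funext fun p => AltTree.unfold_injective (he p))

/-- Actions of `E₀` and `E₁` on the same set, with the maps `f₀`, `f₁` to the final coalgebra of
shapes that they induce. -/
structure ActionPair (E₀ E₁ : StrictDirectedContainer.{u}) (A : Type u) where
  T₀ : E₀.Action A
  T₁ : E₁.Action A
  f₀ : A → Shape₀ E₀ E₁
  f₁ : A → Shape₁ E₀ E₁
  out₀ : ∀ a, (f₀ a).out = ⟨T₀.shape a, fun p => f₁ (T₀.sub a rfl p)⟩
  out₁ : ∀ a, (f₁ a).out = ⟨T₁.shape a, fun p => f₀ (T₁.sub a rfl p)⟩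

namespace ActionPair

variable (T : ActionPair E₀ E₁ A)

theorem shape₀ {a : A} {s : Shape₀ E₀ E₁} (h : T.f₀ a = s) : T.T₀.shape a = s.1 := by
  subst h; exact (congrArg Sigma.fst (T.out₀ a)).symm

theorem shape₁ {a : A} {s : Shape₁ E₀ E₁} (h : T.f₁ a = s) : T.T₁.shape a = s.1 := by
  subst h; exact (congrArg Sigma.fst (T.out₁ a)).symm

theorem next₀ {a : A} {s : Shape₀ E₀ E₁} (h : T.f₀ a = s) (p : E₀.P s.1) :
    T.f₁ (T.T₀.sub a (T.shape₀ h) p) = s.next p := by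
  subst h
  obtain ⟨e, he⟩ := DirectedContainer.sigma_fun_inj (T.out₀ a)
  exact ((he p).trans (congrArg T.f₁ (T.T₀.sub_congr rfl _ _ (cast_heq _ _)))).symm

theorem next₁ {a : A} {s : Shape₁ E₀ E₁} (h : T.f₁ a = s) (p : E₁.P s.1) :
    T.f₀ (T.T₁.sub a (T.shape₁ h) p) = s.next p := by
  subst h
  obtain ⟨e, he⟩ := DirectedContainer.sigma_fun_inj (T.out₁ a)
  exact ((he p).trans (congrArg T.f₀ (T.T₁.sub_congr rfl _ _ (cast_heq _ _)))).symm

/-- The induced shape of `a` is recognized by its first layer and the shapes one step below. -/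
theorem f₀_eq {a : A} {s : Shape₀ E₀ E₁} (h : T.T₀.shape a = s.1)
    (h' : ∀ p, T.f₁ (T.T₀.sub a h p) = s.next p) : T.f₀ a = s := by
  obtain ⟨s, v⟩ := s
  dsimp only at h
  subst h
  exact (T.out₀ a).trans (DirectedContainer.sigma_fun_ext rfl h')

/-- The induced shape of `a` is recognized by its first layer and the shapes one step below. -/
theorem f₁_eq {a : A} {s : Shape₁ E₀ E₁} (h : T.T₁.shape a = s.1)
    (h' : ∀ p, T.f₀ (T.T₁.sub a h p) = s.next p) : T.f₁ a = s := by
  refine Shape₁.out_injective ((T.out₁ a).trans ?_)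
  obtain ⟨s, v⟩ := s
  dsimp only at h
  subst h
  exact DirectedContainer.sigma_fun_ext rfl h'

theorem f₀_sub {a : A} {s : Shape₀ E₀ E₁} (h : T.f₀ a = s) (p : E₀.P s.1) :
    T.f₀ (T.T₀.sub a (T.shape₀ h) p) = s.sub p :=
  T.f₀_eq (T.T₀.shape_sub _ _ _) fun _ =>
    (congrArg T.f₁ (T.T₀.sub_sub _ _ _ _)).trans (T.next₀ h _)

theorem f₁_sub {a : A} {s : Shape₁ E₀ E₁} (h : T.f₁ a = s) (p : E₁.P s.1) :
    T.f₁ (T.T₁.sub a (T.shape₁ h) p) = s.sub p :=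
  T.f₁_eq (T.T₁.shape_sub _ _ _) fun _ =>
    (congrArg T.f₀ (T.T₁.sub_sub _ _ _ _)).trans (T.next₁ h _)

mutual

/-- The element at a position starting in the first container: the two actions are applied
alternately. -/
def sub₀ : {s : Shape₀ E₀ E₁} → Pos₀ s → (a : A) → T.f₀ a = s → A
  | _, .last p, a, h => T.T₀.sub a (T.shape₀ h) p
  | _, .cons p r, a, h => sub₁ r (T.T₀.sub a (T.shape₀ h) p) (T.next₀ h p)

/-- The element at a position starting in the second container. -/
def sub₁ : {s : Shape₁ E₀ E₁} → Pos₁ s → (a : A) → T.f₁ a = s → A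
  | _, .last p, a, h => T.T₁.sub a (T.shape₁ h) p
  | _, .cons p r, a, h => sub₀ r (T.T₁.sub a (T.shape₁ h) p) (T.next₁ h p)

end

mutual

/-- The subshapes at composite positions of the product are the shapes of the elements there. -/
theorem f_sub₀ : ∀ {s : Shape₀ E₀ E₁} (p : Pos₀ s) (a : A) (h : T.f₀ a = s),
    (T.f₀ (T.sub₀ p a h), T.f₁ (T.sub₀ p a h)) = down₀ s p
  | _, .last p, _, h => Prod.ext (T.f₀_sub h p) (T.next₀ h p)
  | _, .cons p r, a, h => f_sub₁ r (T.T₀.sub a (T.shape₀ h) p) (T.next₀ h p)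

theorem f_sub₁ : ∀ {s : Shape₁ E₀ E₁} (p : Pos₁ s) (a : A) (h : T.f₁ a = s),
    (T.f₀ (T.sub₁ p a h), T.f₁ (T.sub₁ p a h)) = down₁ s p
  | _, .last p, _, h => Prod.ext (T.next₁ h p) (T.f₁_sub h p)
  | _, .cons p r, a, h => f_sub₀ r (T.T₁.sub a (T.shape₁ h) p) (T.next₁ h p)

end

/-- The element at an arbitrary position. -/
def sub (a : A) {s : Shape₀ E₀ E₁ × Shape₁ E₀ E₁} (h : (T.f₀ a, T.f₁ a) = s) : PosProd s → A
  | .inl p => T.sub₀ p a (congrArg Prod.fst h)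
  | .inr p => T.sub₁ p a (congrArg Prod.snd h)

mutual

theorem sub_sub₀ : ∀ {s : Shape₀ E₀ E₁} (p : Pos₀ s) (a : A) (h : T.f₀ a = s)
    (p' : PosProd (down₀ s p)), T.sub (T.sub₀ p a h) (T.f_sub₀ p a h) p' = T.sub₀ (plus₀ p p') a h
  | _, .last p, a, h, .inl (.last p') => T.T₀.sub_sub a (T.shape₀ h) p p'
  | s, .last p, a, h, .inl (.cons p' r) => by
    have e := T.T₀.sub_sub a (T.shape₀ h) p p'
    change T.sub₁ r (T.T₀.sub (T.T₀.sub a (T.shape₀ h) p) _ p') _ =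
      T.sub₁ (s := s.next (E₀.plus p p')) r (T.T₀.sub a (T.shape₀ h) (E₀.plus p p')) _
    congr 1
  | _, .last _, _, _, .inr _ => rfl
  | _, .cons p r, a, h, p' => sub_sub₁ r (T.T₀.sub a (T.shape₀ h) p) (T.next₀ h p) p'

theorem sub_sub₁ : ∀ {s : Shape₁ E₀ E₁} (p : Pos₁ s) (a : A) (h : T.f₁ a = s)
    (p' : PosProd (down₁ s p)), T.sub (T.sub₁ p a h) (T.f_sub₁ p a h) p' = T.sub₁ (plus₁ p p') a h
  | _, .last p, a, h, .inr (.last p') => T.T₁.sub_sub a (T.shape₁ h) p p'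
  | s, .last p, a, h, .inr (.cons p' r) => by
    have e := T.T₁.sub_sub a (T.shape₁ h) p p'
    change T.sub₀ r (T.T₁.sub (T.T₁.sub a (T.shape₁ h) p) _ p') _ =
      T.sub₀ (s := s.next (E₁.plus p p')) r (T.T₁.sub a (T.shape₁ h) (E₁.plus p p')) _
    congr 1
  | _, .last _, _, _, .inl _ => rfl
  | _, .cons p r, a, h, p' => sub_sub₀ r (T.T₁.sub a (T.shape₁ h) p) (T.next₁ h p) p'

end

/-- The action of the product given by two actions. -/
def action : (E₀.prod E₁).Action A where
  shape a := (T.f₀ a, T.f₁ a)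
  sub a _ h p := T.sub a h p
  shape_sub a s h p := by
    rcases p with p | p
    · exact T.f_sub₀ p a _
    · exact T.f_sub₁ p a _
  sub_sub a s h p p' := by
    rcases p with p | p
    · exact T.sub_sub₀ p a _ p'
    · exact T.sub_sub₁ p a _ p'

end ActionPair

/-- The first projection: a non-root position `p₀` of `s₀` is sent to the position
`in₀ (p₀, nothing)`. -/
def fst (E₀ E₁ : StrictDirectedContainer.{u}) :
    (E₀.prod E₁).toDirectedContainer ⟶ E₀.toDirectedContainer where
  t s := s.1.1
  q p := p.map fun p₀ => .inl (.last p₀)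
  map_down p := by cases p <;> rfl
  map_root _ := rfl
  map_plus p p' := by
    rcases p with _ | p
    · rfl
    · rcases p' with _ | p' <;> rfl

/-- The second projection, sending `p₁` to `in₁ (p₁, nothing)`. -/
def snd (E₀ E₁ : StrictDirectedContainer.{u}) :
    (E₀.prod E₁).toDirectedContainer ⟶ E₁.toDirectedContainer where
  t s := s.2.1
  q p := p.map fun p₁ => .inr (.last p₁)
  map_down p := by cases p <;> rfl
  map_root _ := rfl
  map_plus p p' := by
    rcases p with _ | p
    · rfl
    · rcases p' with _ | p' <;> rfl

theorem ActionPair.action_comp_fst (T : ActionPair E₀ E₁ A) :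
    T.action.toCoalgebra ≫ (DirectedContainer.interpretation.map (fst E₀ E₁)).app A =
      T.T₀.toCoalgebra := by
  ext a
  refine DirectedContainer.sigma_fun_ext (P := fun s => Option (E₀.P s)) (T.shape₀ rfl).symm
    fun p => ?_
  rcases p with _ | p
  · rw [cast_none (P := E₀.P) (T.shape₀ (a := a) rfl).symm]
    rfl
  · rw [cast_some (P := E₀.P) (T.shape₀ (a := a) rfl).symm]
    exact T.T₀.sub_congr rfl _ _ (cast_heq _ _).symm

theorem ActionPair.action_comp_snd (T : ActionPair E₀ E₁ A) :
    T.action.toCoalgebra ≫ (DirectedContainer.interpretation.map (snd E₀ E₁)).app A =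
      T.T₁.toCoalgebra := by
  ext a
  refine DirectedContainer.sigma_fun_ext (P := fun s => Option (E₁.P s)) (T.shape₁ rfl).symm
    fun p => ?_
  rcases p with _ | p
  · rw [cast_none (P := E₁.P) (T.shape₁ (a := a) rfl).symm]
    rfl
  · rw [cast_some (P := E₁.P) (T.shape₁ (a := a) rfl).symm]
    exact T.T₁.sub_congr rfl _ _ (cast_heq _ _).symm

/-- A pair of coalgebras on the same set, for the comonads interpreting `E₀` and `E₁`, comes from a
coalgebra for the comonad interpreting their product. -/
theorem exists_isCoalgebra_prod (θ₀ : A ⟶ E₀.toDirectedContainer.toComonad.obj A)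
    (θ₁ : A ⟶ E₁.toDirectedContainer.toComonad.obj A)
    (h₀ : IsCoalgebra E₀.toDirectedContainer.toComonad θ₀)
    (h₁ : IsCoalgebra E₁.toDirectedContainer.toComonad θ₁) :
    ∃ θ : A ⟶ (E₀.prod E₁).toDirectedContainer.toComonad.obj A,
      IsCoalgebra (E₀.prod E₁).toDirectedContainer.toComonad θ ∧
      θ ≫ (DirectedContainer.interpretation.map (fst E₀ E₁)).app A = θ₀ ∧
      θ ≫ (DirectedContainer.interpretation.map (snd E₀ E₁)).app A = θ₁ := by
  obtain ⟨T₀, rfl⟩ := Action.exists_toCoalgebra_eq θ₀ h₀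
  obtain ⟨T₁, rfl⟩ := Action.exists_toCoalgebra_eq θ₁ h₁
  obtain ⟨f, ⟨out₀, out₁⟩, -⟩ := shape_final (fun a => ⟨T₀.shape a, fun p => T₀.sub a rfl p⟩)
    fun a => ⟨T₁.shape a, fun p => T₁.sub a rfl p⟩
  let T : ActionPair E₀ E₁ A := ⟨T₀, T₁, f.1, f.2, out₀, out₁⟩
  exact ⟨T.action.toCoalgebra, T.action.isCoalgebra, T.action_comp_fst, T.action_comp_snd⟩

/-- `h` preserves the first layers `s₀`, `s₁` of the shapes in two actions of the product, and the
elements at the positions `in₀ (p₀, nothing)` and `in₁ (p₁, nothing)`, which are called letters. In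
other words, `h` is a morphism for the coalgebras induced on `A` and `B` over `E₀` and `E₁`. -/
structure PreservesLetters (T : (E₀.prod E₁).Action A) (T' : (E₀.prod E₁).Action B) (h : A → B) :
    Prop where
  fst : ∀ a, ∃ e : (T.shape a).1.1 = (T'.shape (h a)).1.1, ∀ p : E₀.P (T.shape a).1.1,
    h (T.sub a rfl (.inl (.last p))) =
      T'.sub (h a) rfl (.inl (.last (cast (congrArg E₀.P e) p)))
  snd : ∀ a, ∃ e : (T.shape a).2.1 = (T'.shape (h a)).2.1, ∀ p : E₁.P (T.shape a).2.1,
    h (T.sub a rfl (.inr (.last p))) =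
      T'.sub (h a) rfl (.inr (.last (cast (congrArg E₁.P e) p)))

theorem PreservesLetters.of_isCoalgebraHom {T : (E₀.prod E₁).Action A}
    {T' : (E₀.prod E₁).Action B} {h : A → B}
    (h₀ : IsCoalgebraHom E₀.toDirectedContainer.toComonad
      (T.toCoalgebra ≫
        (DirectedContainer.interpretation.map (StrictDirectedContainer.fst E₀ E₁)).app A)
      (T'.toCoalgebra ≫
        (DirectedContainer.interpretation.map (StrictDirectedContainer.fst E₀ E₁)).app B)
      (TypeCat.ofHom h))
    (h₁ : IsCoalgebraHom E₁.toDirectedContainer.toComonad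
      (T.toCoalgebra ≫
        (DirectedContainer.interpretation.map (StrictDirectedContainer.snd E₀ E₁)).app A)
      (T'.toCoalgebra ≫
        (DirectedContainer.interpretation.map (StrictDirectedContainer.snd E₀ E₁)).app B)
      (TypeCat.ofHom h)) :
    PreservesLetters T T' h where
  fst a := by
    have H : (⟨(T.shape a).1.1, fun p => h (T.subOpt a (p.map fun p₀ => .inl (.last p₀)))⟩ :
        Σ s : E₀.S, (Option (E₀.P s) → B)) = ⟨(T'.shape (h a)).1.1,
          fun p => T'.subOpt (h a) (p.map fun p₀ => .inl (.last p₀))⟩ :=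
      ConcreteCategory.congr_hom h₀ a
    obtain ⟨e, he⟩ := DirectedContainer.sigma_fun_inj (P := fun s => Option (E₀.P s)) H
    refine ⟨e, fun p => (he (some p)).trans ?_⟩
    rw [cast_some (P := E₀.P) e]
    rfl
  snd a := by
    have H : (⟨(T.shape a).2.1, fun p => h (T.subOpt a (p.map fun p₁ => .inr (.last p₁)))⟩ :
        Σ s : E₁.S, (Option (E₁.P s) → B)) = ⟨(T'.shape (h a)).2.1,
          fun p => T'.subOpt (h a) (p.map fun p₁ => .inr (.last p₁))⟩ :=
      ConcreteCategory.congr_hom h₁ a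
    obtain ⟨e, he⟩ := DirectedContainer.sigma_fun_inj (P := fun s => Option (E₁.P s)) H
    refine ⟨e, fun p => (he (some p)).trans ?_⟩
    rw [cast_some (P := E₁.P) e]
    rfl

namespace PreservesLetters

variable {T : (E₀.prod E₁).Action A} {T' : (E₀.prod E₁).Action B} {h : A → B}

/-- Shapes are preserved by finality: on both sides they are given by maps from the coalgebra of
steps along letters in `A` to the final coalgebra. -/
theorem shape_eq (H : PreservesLetters T T' h) (a : A) : T'.shape (h a) = T.shape a := by
  have next₀ : ∀ {X : Type u} (T : (E₀.prod E₁).Action X) (x : X) (p : E₀.P (T.shape x).1.1),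
      (T.shape (T.sub x rfl (.inl (.last p)))).2 = (T.shape x).1.next p :=
    fun T x p => congrArg Prod.snd (T.shape_sub x rfl (.inl (.last p)))
  have next₁ : ∀ {X : Type u} (T : (E₀.prod E₁).Action X) (x : X) (p : E₁.P (T.shape x).2.1),
      (T.shape (T.sub x rfl (.inr (.last p)))).1 = (T.shape x).2.next p :=
    fun T x p => congrArg Prod.fst (T.shape_sub x rfl (.inr (.last p)))
  have u := (shape_final (E₀ := E₀) (E₁ := E₁)
    (fun a => ⟨(T.shape a).1.1, fun p => T.sub a rfl (.inl (.last p))⟩)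
    (fun a => ⟨(T.shape a).2.1, fun p => T.sub a rfl (.inr (.last p))⟩)).unique
    (y₁ := (fun a => (T'.shape (h a)).1, fun a => (T'.shape (h a)).2))
    (y₂ := (fun a => (T.shape a).1, fun a => (T.shape a).2)) ?_ ?_
  · exact Prod.ext (congrFun (congrArg Prod.fst u) a) (congrFun (congrArg Prod.snd u) a)
  · constructor
    · intro a
      obtain ⟨e, he⟩ := H.fst a
      refine (DirectedContainer.sigma_fun_ext e fun p => ?_).symm
      exact (congrArg (fun b => (T'.shape b).2) (he p)).trans (next₀ T' (h a) _)
    · intro a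
      obtain ⟨e, he⟩ := H.snd a
      refine (DirectedContainer.sigma_fun_ext e fun p => ?_).symm
      exact (congrArg (fun b => (T'.shape b).1) (he p)).trans (next₁ T' (h a) _)
  · exact ⟨fun a => DirectedContainer.sigma_fun_ext rfl fun p => (next₀ T a p).symm,
      fun a => DirectedContainer.sigma_fun_ext rfl fun p => (next₁ T a p).symm⟩

theorem sub_last₀ (H : PreservesLetters T T' h) {s : Shape₀ E₀ E₁ × Shape₁ E₀ E₁} (a : A)
    (e : T.shape a = s) (e' : T'.shape (h a) = s) (p : E₀.P s.1.1) :
    T'.sub (h a) e' (.inl (.last p)) = h (T.sub a e (.inl (.last p))) := by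
  subst e
  obtain ⟨d, hd⟩ := H.fst a
  refine Eq.trans ?_ (hd p).symm
  refine T'.sub_congr rfl _ _ ?_
  clear hd
  generalize T'.shape (h a) = s at *
  subst e'
  rfl

theorem sub_last₁ (H : PreservesLetters T T' h) {s : Shape₀ E₀ E₁ × Shape₁ E₀ E₁} (a : A)
    (e : T.shape a = s) (e' : T'.shape (h a) = s) (p : E₁.P s.2.1) :
    T'.sub (h a) e' (.inr (.last p)) = h (T.sub a e (.inr (.last p))) := by
  subst e
  obtain ⟨d, hd⟩ := H.snd a
  refine Eq.trans ?_ (hd p).symm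
  refine T'.sub_congr rfl _ _ ?_
  clear hd
  generalize T'.shape (h a) = s at *
  subst e'
  rfl

mutual

/-- A position `(p₀, just r)` is the sum of the letter `p₀` and the shorter position `r`, so
elements at all positions are preserved once those at letters are. -/
theorem sub_inl (H : PreservesLetters T T' h) : ∀ {s₀ : Shape₀ E₀ E₁} (p : Pos₀ s₀)
    (s₁ : Shape₁ E₀ E₁) (a : A) (e : T.shape a = (s₀, s₁)) (e' : T'.shape (h a) = (s₀, s₁)),
    T'.sub (h a) e' (.inl p) = h (T.sub a e (.inl p))
  | _, .last p, _, a, e, e' => H.sub_last₀ a e e' p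
  | s₀, .cons p r, s₁, a, e, e' => by
    have k := H.sub_inr r (s₀.sub p) (T.sub a e (.inl (.last p))) (T.shape_sub a e (.inl (.last p)))
      ((H.shape_eq _).trans (T.shape_sub a e (.inl (.last p))))
    refine Eq.trans ?_ (k.trans (congrArg h (T.sub_sub a e (.inl (.last p)) (.inr r))))
    refine (T'.sub_sub (h a) e' (.inl (.last p)) (.inr r)).symm.trans ?_
    exact T'.sub_congr (H.sub_last₀ a e e' p) _ _ HEq.rfl

theorem sub_inr (H : PreservesLetters T T' h) : ∀ {s₁ : Shape₁ E₀ E₁} (p : Pos₁ s₁)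
    (s₀ : Shape₀ E₀ E₁) (a : A) (e : T.shape a = (s₀, s₁)) (e' : T'.shape (h a) = (s₀, s₁)),
    T'.sub (h a) e' (.inr p) = h (T.sub a e (.inr p))
  | _, .last p, _, a, e, e' => H.sub_last₁ a e e' p
  | s₁, .cons p r, s₀, a, e, e' => by
    have k := H.sub_inl r (s₁.sub p) (T.sub a e (.inr (.last p))) (T.shape_sub a e (.inr (.last p)))
      ((H.shape_eq _).trans (T.shape_sub a e (.inr (.last p))))
    refine Eq.trans ?_ (k.trans (congrArg h (T.sub_sub a e (.inr (.last p)) (.inl r))))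
    refine (T'.sub_sub (h a) e' (.inr (.last p)) (.inl r)).symm.trans ?_
    exact T'.sub_congr (H.sub_last₁ a e e' p) _ _ HEq.rfl

end

theorem isCoalgebraHom (H : PreservesLetters T T' h) :
    IsCoalgebraHom (E₀.prod E₁).toDirectedContainer.toComonad T.toCoalgebra T'.toCoalgebra
      (TypeCat.ofHom h) := by
  refine Action.isCoalgebraHom T T' h fun a => ⟨H.shape_eq a, fun p => ?_⟩
  rcases p with p | p
  · exact H.sub_inl p (T.shape a).2 a rfl (H.shape_eq a)
  · exact H.sub_inr p (T.shape a).1 a rfl (H.shape_eq a)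

end PreservesLetters

/-! ### The product -/

/-- The interpretation of the projections is a product of comonads. -/
theorem nonempty_isLimit_interpretation (E₀ E₁ : StrictDirectedContainer.{u}) :
    Nonempty (IsLimit (BinaryFan.mk (DirectedContainer.interpretation.map (fst E₀ E₁))
      (DirectedContainer.interpretation.map (snd E₀ E₁)))) := by
  refine nonempty_isLimit_of_coalgebra _ _ exists_isCoalgebra_prod ?_
  intro A B θ θ' h hθ hθ' h₀ h₁
  obtain ⟨T, rfl⟩ := Action.exists_toCoalgebra_eq θ hθ
  obtain ⟨T', rfl⟩ := Action.exists_toCoalgebra_eq θ' hθ'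
  exact (PreservesLetters.of_isCoalgebraHom (h := h) h₀ h₁).isCoalgebraHom

end StrictDirectedContainer

theorem mainTheorem5 (E₀ E₁ : StrictDirectedContainer.{u}) :
    ∃ (π₀ : (E₀.prod E₁).toDirectedContainer ⟶ E₀.toDirectedContainer)
      (π₁ : (E₀.prod E₁).toDirectedContainer ⟶ E₁.toDirectedContainer),
      Nonempty (IsLimit (BinaryFan.mk π₀ π₁)) ∧
      Nonempty (IsLimit (BinaryFan.mk
        (DirectedContainer.interpretation.map π₀) (DirectedContainer.interpretation.map π₁))) ∧
      Nonempty (IsLimit (BinaryFan.mk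
        (DirectedContainer.interpretation.map π₀ ≫ E₀.coidealIso.hom)
        (DirectedContainer.interpretation.map π₁ ≫ E₁.coidealIso.hom))) := by
  obtain ⟨L⟩ := StrictDirectedContainer.nonempty_isLimit_interpretation E₀ E₁
  have := DirectedContainer.interpretationFullyFaithful.{u}.full
  have := DirectedContainer.interpretationFullyFaithful.{u}.faithful
  exact ⟨StrictDirectedContainer.fst E₀ E₁, StrictDirectedContainer.snd E₀ E₁,
    ⟨isLimitOfReflectsOfMapIsLimit DirectedContainer.interpretation _ _ L⟩, ⟨L⟩,
    ⟨BinaryFan.isLimitCompRightIso _ E₁.coidealIso.hom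
      (BinaryFan.isLimitCompLeftIso _ E₀.coidealIso.hom L)⟩⟩
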